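/- Let $G$ be a Polish group admitting a two-sided invariant metric, i.e. a metric $d$ inducing the topology of $G$ with $d(gx,gy)=d(x,y)=d(xg,yg)$ for all $g,x,y\in G$. Let $X$ be a Polish $G$-space, i.e. a Polish space with a continuous action $G\times X\to X$, and suppose that the orbit equivalence relation $E^X_G=\{(x,y)\in X\times X:\exists g\in G\ g\cdot x=y\}$ is a Borel subset of $X\times X$. For $V\subseteq G$, call a set $B\subseteq X$ $V$-lacunary if $g\cdot x=y$ with $g\in V$ and $x,y\in B$ implies $x=y$, and call $B$ a complete section of $E^X_G$ if it meets every orbit. Let $V\subseteq G$ be an open neighbourhood of $1_G$ that is symmetric ($V^{-1}=V$) and conjugacy-invariant ($gVg^{-1}=V$ for all $g\in G$), and let $B\subseteq X$ be a Borel $V$-lacunary complete section of $E^X_G$. Then there is a Borel $V$-lacunary complete section $C\supseteq B$ of $E^X_G$ such that $V^2\cdot C=X$, where $V^2=\{vw:v,w\in V\}$ and $V^2\cdot C=\{g\cdot c: g\in V^2,\ c\in C\}$. -/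

import Mathlib

open scoped Pointwise

/-- The topological group `G` admits a two-sided invariant metric: there is a metric on `G`
inducing the given topology and invariant under left and right translations. -/
def AdmitsTwoSidedInvariantMetric (G : Type*) [Group G] [t : TopologicalSpace G] : Prop :=
  ∃ m : MetricSpace G, m.toUniformSpace.toTopologicalSpace = t ∧
    ∀ g x y : G, m.dist (g * x) (g * y) = m.dist x y ∧ m.dist (x * g) (y * g) = m.dist x y

/-- The orbit equivalence relation of the action of `G` on `X`, as a subset of `X × X`,
is Borel. (For second countable `X` the product σ-algebra is the Borel σ-algebra of `X × X`.) -/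
def IsBorelOrbitRel (G X : Type*) [Group G] [MulAction G X] [MeasurableSpace X] : Prop :=
  MeasurableSet {p : X × X | MulAction.orbitRel G X p.1 p.2}

/-- `B` is a complete section of the orbit equivalence relation: it meets every orbit,
that is, its saturation is all of `X`. -/
def IsCompleteSection (G : Type*) {X : Type*} [Group G] [MulAction G X] (B : Set X) : Prop :=
  ∀ x : X, ∃ b ∈ B, MulAction.orbitRel G X b x

/-- `B` is `V`-lacunary: if `g • x = y` for some `g ∈ V` and `x, y ∈ B`, then `x = y`. -/
def IsLacunary {G X : Type*} [Group G] [MulAction G X] (V : Set G) (B : Set X) : Prop :=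
  ∀ g ∈ V, ∀ x ∈ B, ∀ y ∈ B, g • x = y → x = y

/-!
Let `(g n)` be dense in `G`. Since `V` is conjugacy-invariant, every translate `g n • B` is again
Borel and `V`-lacunary, and since `B` meets every orbit, the sets `V • (g n • B)` cover `X`. Put
`C 0 = B` and `C (n + 1) = C n ∪ (g n • B \ V • C n)`. Each `C n` is `V`-lacunary
(`IsLacunary.union_diff_smul`), and a point of `V • (g n • B)` is moved by an element of `V` to a
point of `C (n + 1)` or of `V • C n`; so `C = ⋃ n, C n` satisfies `V ^ 2 • C = X`.

What has to be shown is that the construction stays Borel, i.e. that `V • C` is Borel for a Borel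
`V`-lacunary set `C` (`IsLacunary.measurableSet_smul`). The set `V` is a countable union of open
sets `O` with `O⁻¹ * O ⊆ V`, and for these the projection of `{(c, y) | c ∈ C, y ∈ O • c}` to `y` is
injective; by the Lusin–Souslin theorem it suffices that the relation `y ∈ O • x` be Borel.

This last fact is a theorem of Becker and Kechris
(`IsBorelOrbitRel.measurableSet_exists_smul_eq`). It is deduced from a countable family of Borel
subsets of `X × X` whose sections form, in every orbit, a basis of the quotient topology coming
from `G` (`IsBorelOrbitRel.exists_countable_basis`): membership of `y` in the closure of `O • x`
within the orbit can then be tested on a countable dense subset of `O`. The family consists of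
Vaught transforms of the basic open sets of a Polish topology on `X × X` which is finer than the
given one, makes the orbit relation closed, and is closed under taking Vaught transforms on the
second coordinate (`exists_polishSpace_le_isOpen_apply`; the Vaught transforms of Borel sets are
Borel by `measurableSet_frequently_residual`). Each orbit is then closed in this topology, and a
Baire category argument (`exists_dense_in_actionOpen`) together with a back-and-forth construction
in the manner of Effros's theorem (`exists_actionOpen_subset_smul`) shows that the sets `W • y`,
for `W` a neighbourhood of `1`, are neighbourhoods of `y` in the topology generated by the Vaught
transforms.
-/

open Filter Topology Set

/-! ### Category quantifiers and Vaught transforms -/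

theorem frequently_residual_of_isOpen {α : Type*} [TopologicalSpace α] [BaireSpace α]
    {O : Set α} (hO : IsOpen O) (hne : O.Nonempty) : ∃ᶠ a in residual α, a ∈ O :=
  fun h => not_isMeagre_of_isOpen hO hne h

theorem exists_of_eventually_residual {α : Type*} [TopologicalSpace α] [BaireSpace α] [Nonempty α]
    {p : α → Prop} (h : ∀ᶠ a in residual α, p a) : ∃ a, p a :=
  (dense_of_mem_residual h).nonempty

theorem frequently_countable_exists {α ι : Type*} [Countable ι] {l : Filter α}
    [CountableInterFilter l] {p : ι → α → Prop} :
    (∃ᶠ a in l, ∃ i, p i a) ↔ ∃ i, ∃ᶠ a in l, p i a := by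
  simp only [Filter.Frequently, not_exists, eventually_countable_forall, not_forall]

theorem frequently_residual_mul_right {G : Type*} [Group G] [TopologicalSpace G]
    [IsTopologicalGroup G] {p : G → Prop} (h : G) :
    (∃ᶠ g in residual G, p (g * h)) ↔ ∃ᶠ g in residual G, p g := by
  conv_rhs => rw [← (Homeomorph.mulRight h).residual_map_eq, frequently_map]
  rfl

/-- `f` is *residually continuous* at `a` if every neighbourhood of `f a` contains `f b` for
all `b` in a relatively comeagre subset of some neighbourhood of `a`. -/
def ResidualContinuousAt {α β : Type*} [TopologicalSpace α] [TopologicalSpace β]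
    (f : α → β) (a : α) : Prop :=
  ∀ Q : Set β, IsOpen Q → f a ∈ Q →
    ∃ O : Set α, IsOpen O ∧ a ∈ O ∧ ∀ᶠ b in residual α, b ∈ O → f b ∈ Q

/-- A Baire measurable map into a second countable space is residually continuous at the points
of a comeagre set. -/
theorem eventually_residualContinuousAt {α β : Type*} [TopologicalSpace α] [TopologicalSpace β]
    [SecondCountableTopology β] {f : α → β}
    (hf : ∀ Q : Set β, IsOpen Q → BaireMeasurableSet (f ⁻¹' Q)) :
    ∀ᶠ a in residual α, ResidualContinuousAt f a := by
  have hb := TopologicalSpace.isBasis_countableBasis β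
  have hc := TopologicalSpace.countable_countableBasis β
  have : ∀ Q : TopologicalSpace.countableBasis β, ∃ u : Set α, IsOpen u ∧ (f ⁻¹' Q.1) =ᵇ u :=
    fun Q => (hf Q.1 (hb.isOpen Q.2)).residualEq_isOpen
  choose u huo hue using this
  have hc' : Countable (TopologicalSpace.countableBasis β) := hc.to_subtype
  have hall : ∀ᶠ a in residual α, ∀ Q : TopologicalSpace.countableBasis β,
      (a ∈ f ⁻¹' Q.1 ↔ a ∈ u Q) :=
    eventually_countable_forall.2 fun Q => Filter.eventuallyEq_set.1 (hue Q)
  filter_upwards [hall] with a ha Q hQ haQ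
  obtain ⟨R, hR, haR, hRQ⟩ := hb.exists_subset_of_mem_open haQ hQ
  refine ⟨u ⟨R, hR⟩, huo _, (ha ⟨R, hR⟩).1 haR, ?_⟩
  filter_upwards [hall] with b hb' hbu
  exact hRQ ((hb' ⟨R, hR⟩).2 hbu)

/-- The Vaught transform `A^{ΔU}`: the points `z` such that `g • z ∈ A` for nonmeagrely many
`g ∈ U`. -/
def vaught {G Z : Type*} [Group G] [TopologicalSpace G] [MulAction G Z] (A : Set Z) (U : Set G) :
    Set Z :=
  {z | ∃ᶠ g in residual G, g ∈ U ∧ g • z ∈ A}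

theorem vaught_mono {G Z : Type*} [Group G] [TopologicalSpace G] [MulAction G Z]
    {A A' : Set Z} {U U' : Set G} (hA : A ⊆ A') (hU : U ⊆ U') : vaught A U ⊆ vaught A' U' :=
  fun _ hz => hz.mono fun _ hg => ⟨hU hg.1, hA hg.2⟩

theorem mem_vaught_of_residualContinuousAt {G Z : Type*} [Group G] [TopologicalSpace G]
    [BaireSpace G] [MulAction G Z] [TopologicalSpace Z] {z : Z} {g : G}
    (hg : ResidualContinuousAt (fun h : G => h • z) g) {A : Set Z} {U : Set G} (hA : IsOpen A)
    (hU : IsOpen U) (hgU : g ∈ U) (hgA : g • z ∈ A) : z ∈ vaught A U := by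
  obtain ⟨O, hO, hgO, hOA⟩ := hg A hA hgA
  have := (frequently_residual_of_isOpen (hO.inter hU) ⟨g, hgO, hgU⟩).and_eventually hOA
  exact this.mono fun h hh => ⟨hh.1.2, hh.2 hh.1.1⟩

/-- The Montgomery–Novikov theorem: for a measurable set `D`, the set of parameters
whose section is nonmeagre in a given open set is measurable. -/
theorem measurableSet_frequently_residual {T α : Type*} [MeasurableSpace T]
    [TopologicalSpace α] [SecondCountableTopology α] [BaireSpace α] [MeasurableSpace α]
    [BorelSpace α] {D : Set (T × α)} (hD : MeasurableSet D) :
    ∀ U : Set α, IsOpen U → MeasurableSet {t | ∃ᶠ a in residual α, a ∈ U ∧ (t, a) ∈ D} := by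
  have hsec : ∀ D : Set (T × α), MeasurableSet D → ∀ t, MeasurableSet (Prod.mk t ⁻¹' D) :=
    fun D hD t => measurable_prodMk_left hD
  rw [← generateFrom_prod] at hD
  refine MeasurableSpace.generateFrom_induction (C := {s : Set (T × α) | ∃ t, MeasurableSet t ∧
    ∃ u, MeasurableSet u ∧ t ×ˢ u = s}) (p := fun D _ => ∀ U : Set α, IsOpen U →
    MeasurableSet {t | ∃ᶠ a in residual α, a ∈ U ∧ (t, a) ∈ D}) ?_ ?_ ?_ ?_ D hD
  · rintro _ ⟨s, hs, u, -, rfl⟩ - U -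
    by_cases h : ∃ᶠ a in residual α, a ∈ U ∧ a ∈ u
    · convert hs using 1
      ext t
      refine ⟨fun ht => (ht.exists.choose_spec).2.1, fun ht => h.mono fun a ha => ⟨ha.1, ht, ha.2⟩⟩
    · convert MeasurableSet.empty using 1
      ext t
      simp only [mem_ofPred_eq, mem_empty_iff_false, iff_false]
      exact fun ht => h (ht.mono fun a ha => ⟨ha.1, ha.2.2⟩)
  · intro U _
    convert MeasurableSet.empty using 1
    ext t; simp
  · intro D hD ih U hU
    replace hD : MeasurableSet D := by rw [← generateFrom_prod]; exact hD
    -- `Dᶜ` is nonmeagre in `U` iff `D` is meagre in some nonempty basic open subset of `U`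
    have hb := TopologicalSpace.isBasis_countableBasis α
    have key : {t | ∃ᶠ a in residual α, a ∈ U ∧ (t, a) ∈ Dᶜ} =
        ⋃ W ∈ {W ∈ TopologicalSpace.countableBasis α | W ⊆ U ∧ W.Nonempty},
          {t | ∃ᶠ a in residual α, a ∈ W ∧ (t, a) ∈ D}ᶜ := by
      ext t
      simp only [mem_ofPred_eq, mem_iUnion, mem_compl_iff, exists_prop]
      constructor
      · intro h
        obtain ⟨u, huo, hue⟩ := ((hsec D hD t).compl).residualEq_isOpen
        rw [Filter.eventuallyEq_set] at hue
        obtain ⟨a, ⟨haU, haD⟩, hau⟩ := (h.and_eventually hue).exists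
        obtain ⟨W, hW, haW, hWu⟩ := hb.exists_subset_of_mem_open
          (show a ∈ U ∩ u from ⟨haU, hau.1 haD⟩) (hU.inter huo)
        refine ⟨W, ⟨hW, fun x hx => (hWu hx).1, ⟨a, haW⟩⟩, ?_⟩
        rw [not_frequently]
        filter_upwards [hue] with b hb' hbW
        exact hb'.2 (hWu hbW.1).2 hbW.2
      · rintro ⟨W, ⟨hW, hWU, hne⟩, h⟩
        rw [not_frequently] at h
        exact ((frequently_residual_of_isOpen (hb.isOpen hW) hne).and_eventually h).mono
          fun a ha => ⟨hWU ha.1, fun haD => ha.2 ⟨ha.1, haD⟩⟩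
    rw [key]
    refine MeasurableSet.biUnion
      ((TopologicalSpace.countable_countableBasis α).mono fun W hW => hW.1) fun W hW => ?_
    exact (ih W (hb.isOpen hW.1)).compl
  · intro D _ ih U hU
    convert MeasurableSet.iUnion fun n => ih n U hU using 1
    ext t
    simp only [mem_ofPred_eq, mem_iUnion, ← frequently_countable_exists]
    simp

/-! ### The action topology on an orbit -/

/-- `N` is open in the quotient topology of the action map `G × Y → Y`. When the Vaught transforms
of open sets are open, they form a basis of this topology (`actionOpen_vaught`,
`ActionOpen.exists_vaught_subset`). -/
def ActionOpen (G : Type*) {Y : Type*} [Group G] [TopologicalSpace G] [TopologicalSpace Y]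
    [MulAction G Y] (N : Set Y) : Prop :=
  IsOpen {p : G × Y | p.1 • p.2 ∈ N}

section

variable {G Y : Type*} [Group G] [TopologicalSpace G]
  [TopologicalSpace Y] [MulAction G Y]

theorem ActionOpen.inter {N N' : Set Y} (h : ActionOpen G N) (h' : ActionOpen G N') :
    ActionOpen G (N ∩ N') :=
  IsOpen.inter h h'

theorem actionOpen_preimage {X : Type*} [TopologicalSpace X] [MulAction G X] [ContinuousSMul G X]
    {i : Y → X} (hi : Continuous i) (hsmul : ∀ (g : G) (y : Y), i (g • y) = g • i y) {P : Set X}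
    (hP : IsOpen P) : ActionOpen G (i ⁻¹' P) := by
  have : Continuous fun p : G × Y => p.1 • i p.2 := by fun_prop
  simp only [ActionOpen, mem_preimage, hsmul]
  exact hP.preimage this

variable [IsTopologicalGroup G]

theorem ActionOpen.preimage_smul {N : Set Y} (h : ActionOpen G N) (g : G) :
    ActionOpen G {z | g • z ∈ N} := by
  have : Continuous fun p : G × Y => ((g * p.1, p.2) : G × Y) := by fun_prop
  simpa only [ActionOpen, preimage_ofPred_eq, mul_smul, mem_ofPred_eq] using IsOpen.preimage this h

theorem ActionOpen.isOpen_inv_smul {N : Set Y} (h : ActionOpen G N) :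
    IsOpen {p : G × Y | p.1⁻¹ • p.2 ∈ N} := by
  have : Continuous fun p : G × Y => ((p.1⁻¹, p.2) : G × Y) := by fun_prop
  exact IsOpen.preimage this h

variable [PolishSpace G] [PolishSpace Y]

theorem ActionOpen.exists_vaught_subset
    (hB : ∀ (y : Y) (Q : Set Y), IsOpen Q → BaireMeasurableSet ((fun g : G => g • y) ⁻¹' Q))
    {N : Set Y} (h : ActionOpen G N) {y : Y} (hy : y ∈ N) :
    ∃ (A : Set Y) (U : Set G), IsOpen A ∧ IsOpen U ∧ y ∈ vaught A U ∧ vaught A U ⊆ N := by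
  obtain ⟨g, hg⟩ := exists_of_eventually_residual (eventually_residualContinuousAt (hB y))
  have hmem : ((g, g • y) : G × Y) ∈ {p : G × Y | p.1⁻¹ • p.2 ∈ N} := by simpa using hy
  obtain ⟨U, A, hU, hA, hgU, hgA, hUA⟩ := isOpen_prod_iff.1 h.isOpen_inv_smul g (g • y) hmem
  refine ⟨A, U, hA, hU, mem_vaught_of_residualContinuousAt hg hA hU hgU hgA, fun z hz => ?_⟩
  obtain ⟨k, hkU, hkA⟩ := hz.exists
  simpa using hUA (mk_mem_prod hkU hkA)

theorem actionOpen_vaught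
    (hB : ∀ (y : Y) (Q : Set Y), IsOpen Q → BaireMeasurableSet ((fun g : G => g • y) ⁻¹' Q))
    (hV : ∀ (A : Set Y) (U : Set G), IsOpen A → IsOpen U → IsOpen (vaught A U))
    {A : Set Y} {U : Set G} (hA : IsOpen A) (hU : IsOpen U) : ActionOpen G (vaught A U) := by
  rw [ActionOpen, isOpen_iff_mem_nhds]
  rintro ⟨g₀, z₀⟩ hz₀
  obtain ⟨k, ⟨hkU, hkA⟩, hk⟩ :=
    (Frequently.and_eventually hz₀ (eventually_residualContinuousAt (hB (g₀ • z₀)))).exists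
  obtain ⟨O, hO, hkO, hOA⟩ := hk A hA hkA
  -- a neighbourhood `O₁` of `k` whose translates `O₁ g₀ g⁻¹`, for `g` near `g₀`, stay in `U`
  have hcont : Continuous fun p : G × G => p.1 * g₀ * p.2⁻¹ := by fun_prop
  obtain ⟨O₁, W, hO₁, hW, hkO₁, hgW, hOW⟩ := isOpen_prod_iff.1 (hU.preimage hcont) k g₀
    (by simpa using hkU)
  have hopen : IsOpen (vaught A {h : G | h * g₀⁻¹ ∈ O ∩ O₁}) :=
    hV _ _ hA ((hO.inter hO₁).preimage (continuous_mul_const g₀⁻¹))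
  have hmem : z₀ ∈ vaught A {h : G | h * g₀⁻¹ ∈ O ∩ O₁} := by
    refine (frequently_residual_mul_right g₀).1 ?_
    refine ((frequently_residual_of_isOpen (hO.inter hO₁) ⟨k, hkO, hkO₁⟩).and_eventually hOA).mono
      fun h hh => ⟨by simpa using hh.1, ?_⟩
    rw [mul_smul]
    exact hh.2 hh.1.1
  filter_upwards [prod_mem_nhds (hW.mem_nhds hgW) (hopen.mem_nhds hmem)]
  rintro ⟨g, z⟩ ⟨hg, hz⟩
  refine (frequently_residual_mul_right g⁻¹).1 (Frequently.mono hz fun h hh => ⟨?_, ?_⟩)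
  · have := hOW (mk_mem_prod hh.1.2 hg)
    simpa using this
  · simpa [mul_smul] using hh.2

/-- The action topology is not meagre in itself: a countable cover has a member that is
dense in some nonempty open set. The points `(g, q)` all of whose neighbourhoods `U × A` have
nonempty `A^{ΔU}` form a closed, hence Polish, subspace of `G × Y`, which the map
`(g, q) ↦ g⁻¹ • q` connects with the action topology; Baire's theorem is applied there. -/
theorem exists_dense_in_actionOpen
    (hB : ∀ (y : Y) (Q : Set Y), IsOpen Q → BaireMeasurableSet ((fun g : G => g • y) ⁻¹' Q))
    (hV : ∀ (A : Set Y) (U : Set G), IsOpen A → IsOpen U → IsOpen (vaught A U))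
    [Nonempty Y] (F : ℕ → Set Y) (hF : ∀ y, ∃ n, y ∈ F n) :
    ∃ n, ∃ N : Set Y, ActionOpen G N ∧ N.Nonempty ∧
      ∀ N' : Set Y, ActionOpen G N' → N' ⊆ N → N'.Nonempty → (N' ∩ F n).Nonempty := by
  by_contra! H
  let K : Set (G × Y) := {p | ∀ (U : Set G) (A : Set Y), IsOpen U → IsOpen A → p.1 ∈ U → p.2 ∈ A →
    (vaught A U).Nonempty}
  have hKmem : ∀ (g : G) (z : Y), ResidualContinuousAt (fun h : G => h • z) g → (g, g • z) ∈ K :=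
    fun g z hg U A hU hA hgU hgA => ⟨z, mem_vaught_of_residualContinuousAt hg hA hU hgU hgA⟩
  have hKclosed : IsClosed K := by
    rw [← isOpen_compl_iff, isOpen_iff_forall_mem_open]
    intro p hp
    have : ∃ (U : Set G) (A : Set Y), IsOpen U ∧ IsOpen A ∧ p.1 ∈ U ∧ p.2 ∈ A ∧
        ¬ (vaught A U).Nonempty := by
      by_contra! h
      exact hp h
    obtain ⟨U, A, hU, hA, hpU, hpA, hne⟩ := this
    exact ⟨U ×ˢ A, fun q hq hqK => hne (hqK U A hU hA hq.1 hq.2), hU.prod hA, hpU, hpA⟩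
  have : PolishSpace K := hKclosed.polishSpace
  have hKne : Nonempty K := by
    obtain ⟨z⟩ := ‹Nonempty Y›
    obtain ⟨g, hg⟩ := exists_of_eventually_residual (eventually_residualContinuousAt (hB z))
    exact ⟨⟨_, hKmem g z hg⟩⟩
  have hdense : ∀ n, Dense (interior {k : K | k.1.1⁻¹ • k.1.2 ∉ F n}) := by
    intro n
    rw [dense_iff_inter_open]
    rintro V hVo ⟨⟨⟨g, q⟩, hk⟩, hkV⟩
    obtain ⟨V', hV', rfl⟩ := isOpen_induced_iff.1 hVo
    obtain ⟨U, A, hU, hA, hgU, hqA, hUA⟩ := isOpen_prod_iff.1 hV' g q hkV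
    obtain ⟨N', hN', hN'sub, ⟨z, hz⟩, hdisj⟩ := H n (vaught A U) (actionOpen_vaught hB hV hA hU)
      (hk U A hU hA hgU hqA)
    obtain ⟨h, ⟨hhU, hhA⟩, hh⟩ :=
      (Frequently.and_eventually (hN'sub hz) (eventually_residualContinuousAt (hB z))).exists
    refine ⟨⟨(h, h • z), hKmem h z hh⟩, hUA (mk_mem_prod hhU hhA), ?_⟩
    refine mem_interior.2 ⟨Subtype.val ⁻¹' {p : G × Y | p.1⁻¹ • p.2 ∈ N'}, fun k hkN hkF => ?_,
      hN'.isOpen_inv_smul.preimage continuous_subtype_val, by simpa using hz⟩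
    exact (hdisj.subset ⟨hkN, hkF⟩ : k.1.1⁻¹ • k.1.2 ∈ (∅ : Set Y))
  obtain ⟨k, hk⟩ := (dense_iInter_of_isOpen (fun n => isOpen_interior) hdense).nonempty
  obtain ⟨n, hn⟩ := hF (k.1.1⁻¹ • k.1.2)
  exact interior_subset (mem_iInter.1 hk n) hn

/-- The category half of Effros's theorem: for a neighbourhood `W` of `1`, the set `W • y` is dense
in a neighbourhood of `y` for the action topology. -/
theorem exists_actionOpen_dense_smul [MulAction.IsPretransitive G Y]
    (hB : ∀ (y : Y) (Q : Set Y), IsOpen Q → BaireMeasurableSet ((fun g : G => g • y) ⁻¹' Q))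
    (hV : ∀ (A : Set Y) (U : Set G), IsOpen A → IsOpen U → IsOpen (vaught A U))
    {W : Set G} (hW : W ∈ 𝓝 (1 : G)) (y : Y) :
    ∃ N : Set Y, ActionOpen G N ∧ y ∈ N ∧
      ∀ N' : Set Y, ActionOpen G N' → N' ⊆ N → N'.Nonempty → ∃ w ∈ W, w • y ∈ N' := by
  have hcont : Continuous fun p : G × G => p.1⁻¹ * p.2 := by fun_prop
  have hW' : (fun p : G × G => p.1⁻¹ * p.2) ⁻¹' W ∈ 𝓝 ((1, 1) : G × G) :=
    hcont.continuousAt.preimage_mem_nhds (by simpa using hW)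
  rw [nhds_prod_eq, mem_prod_same_iff] at hW'
  obtain ⟨W₁, hW₁, hWW⟩ := hW'
  obtain ⟨g, hg⟩ := TopologicalSpace.exists_dense_seq G
  have : Nonempty Y := ⟨y⟩
  obtain ⟨n, N, hN, hNne, hdense⟩ := exists_dense_in_actionOpen hB hV
    (fun n => {z : Y | ∃ w ∈ W₁, z = g n • w • y}) (fun z => by
      obtain ⟨h, rfl⟩ := MulAction.exists_smul_eq G y z
      have hc : Continuous fun k : G => k⁻¹ * h := by fun_prop
      have : (fun k : G => k⁻¹ * h) ⁻¹' W₁ ∈ 𝓝 h :=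
        hc.continuousAt.preimage_mem_nhds (by simpa using hW₁)
      obtain ⟨n, hn⟩ := hg.exists_mem_open isOpen_interior ⟨h, mem_interior_iff_mem_nhds.2 this⟩
      exact ⟨n, (g n)⁻¹ * h, interior_subset (s := (fun k : G => k⁻¹ * h) ⁻¹' W₁) hn, by
        simp [← mul_smul]⟩)
  obtain ⟨_, hzN, w₀, hw₀, rfl⟩ := hdense N hN subset_rfl hNne
  refine ⟨{z | (g n * w₀) • z ∈ N}, hN.preimage_smul _, by simpa [mul_smul] using hzN, ?_⟩
  rintro N' hN' hsub ⟨z, hz⟩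
  obtain ⟨_, hx, w, hw, rfl⟩ := hdense {x | (g n * w₀)⁻¹ • x ∈ N'} (hN'.preimage_smul _)
    (fun x hx => by simpa [mul_smul] using hsub hx) ⟨(g n * w₀) • z, by simpa [mul_smul] using hz⟩
  refine ⟨w₀⁻¹ * w, hWW (mk_mem_prod hw₀ hw), ?_⟩
  simpa [mul_smul] using hx

/-- Effros's theorem for the action topology: `W • y` is a neighbourhood of `y` for
every neighbourhood `W` of `1`. Points `y` and `z` that are close in the action topology are moved towards each other
back and forth by a sequence of ever smaller group elements; the products of these converge in `G`,
and the limits carry `y` and `z` to the same point. -/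
theorem exists_actionOpen_subset_smul [MulAction.IsPretransitive G Y]
    {X : Type*} [TopologicalSpace X] [T2Space X] [MulAction G X] [ContinuousSMul G X]
    {i : Y → X} (hi : Continuous i) (hsmul : ∀ (g : G) (y : Y), i (g • y) = g • i y)
    (hinj : Function.Injective i)
    (hB : ∀ (y : Y) (Q : Set Y), IsOpen Q → BaireMeasurableSet ((fun g : G => g • y) ⁻¹' Q))
    (hV : ∀ (A : Set Y) (U : Set G), IsOpen A → IsOpen U → IsOpen (vaught A U))
    {W : Set G} (hW : W ∈ 𝓝 (1 : G)) (y : Y) :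
    ∃ N : Set Y, ActionOpen G N ∧ y ∈ N ∧ ∀ z ∈ N, ∃ w ∈ W, z = w • y := by
  let := TopologicalSpace.upgradeIsCompletelyMetrizable G
  have hcont : Continuous fun p : G × G => p.1⁻¹ * p.2 := by fun_prop
  have hW' : (fun p : G × G => p.1⁻¹ * p.2) ⁻¹' W ∈ 𝓝 ((1, 1) : G × G) :=
    hcont.continuousAt.preimage_mem_nhds (by simpa using hW)
  rw [nhds_prod_eq, mem_prod_same_iff] at hW'
  obtain ⟨W₁, hW₁, hWW⟩ := hW'
  obtain ⟨T, ⟨hT, hTc⟩, hTW⟩ := (closed_nhds_basis (1 : G)).mem_iff.1 hW₁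
  -- the set of `w` that move `p` by less than `(1/2)^n` without leaving the interior of `T`
  let S : ℕ → G → Set G := fun n p => {w | w * p ∈ interior T ∧ dist (w * p) p < (1 / 2) ^ n}
  have hS : ∀ n p, p ∈ interior T → S n p ∈ 𝓝 (1 : G) := by
    intro n p hp
    have hc : Continuous fun w : G => w * p := by fun_prop
    have h1 : (fun w : G => w * p) ⁻¹' interior T ∈ 𝓝 (1 : G) :=
      hc.continuousAt.preimage_mem_nhds (by simpa using isOpen_interior.mem_nhds hp)
    have h2 : (fun w : G => w * p) ⁻¹' Metric.ball p ((1 / 2) ^ n) ∈ 𝓝 (1 : G) :=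
      hc.continuousAt.preimage_mem_nhds (by simpa using Metric.ball_mem_nhds p (by positivity))
    exact inter_mem h1 h2
  have h1T : (1 : G) ∈ interior T := mem_interior_iff_mem_nhds.2 hT
  obtain ⟨N, hN, hyN, hdense⟩ := exists_actionOpen_dense_smul hB hV (hS 0 1 h1T) y
  refine ⟨N, hN, hyN, fun z hz => ?_⟩
  -- stage `n` consists of a pair `(p, q)` for which `q • z` lies in the closure of `S n p • p • y`
  let P : ℕ → G × G → Prop := fun n s => s.1 ∈ interior T ∧ s.2 ∈ interior T ∧
    ∀ N' : Set Y, ActionOpen G N' → s.2 • z ∈ N' → ∃ w ∈ S n s.1, w • s.1 • y ∈ N'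
  have hP0 : P 0 (1, 1) := by
    refine ⟨h1T, h1T, fun N' hN' hz' => ?_⟩
    obtain ⟨w, hw, hwN⟩ := hdense (N' ∩ N) (hN'.inter hN) inter_subset_right
      ⟨z, by simpa using hz', hz⟩
    exact ⟨w, hw, by simpa using hwN.1⟩
  have hstep : ∀ n s, P n s → ∃ s', P (n + 1) s' ∧
      dist s.1 s'.1 ≤ 1 * (1 / 2) ^ n ∧ dist s.2 s'.2 ≤ 1 * (1 / 2) ^ n := by
    rintro n ⟨p, q⟩ ⟨hp, hq, hpq⟩
    obtain ⟨N₁, hN₁, hqN₁, hd₁⟩ := exists_actionOpen_dense_smul hB hV (hS n q hq) (q • z)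
    obtain ⟨w, hw, hwN⟩ := hpq N₁ hN₁ hqN₁
    obtain ⟨N₂, hN₂, hpN₂, hd₂⟩ :=
      exists_actionOpen_dense_smul hB hV (hS (n + 1) (w * p) hw.1) ((w * p) • y)
    obtain ⟨w', hw', hwN'⟩ := hd₁ (N₂ ∩ N₁) (hN₂.inter hN₁) inter_subset_right
      ⟨(w * p) • y, hpN₂, by simpa [mul_smul] using hwN⟩
    refine ⟨(w * p, w' * q), ⟨hw.1, hw'.1, fun N' hN' hz' => ?_⟩, ?_, ?_⟩
    · obtain ⟨v, hv, hvN⟩ := hd₂ (N' ∩ N₂) (hN'.inter hN₂) inter_subset_right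
        ⟨(w' * q) • z, hz', by simpa [mul_smul] using hwN'.1⟩
      exact ⟨v, hv, hvN.1⟩
    · rw [one_mul, dist_comm]; exact hw.2.le
    · rw [one_mul, dist_comm]; exact hw'.2.le
  choose! next hnext using hstep
  let s : ℕ → G × G := fun n => Nat.rec (1, 1) next n
  have hs : ∀ n, P n (s n) := fun n => Nat.rec hP0 (fun n ih => (hnext n (s n) ih).1) n
  obtain ⟨u, hu⟩ := cauchySeq_tendsto_of_complete (cauchySeq_of_le_geometric (f := fun n => (s n).1)
    (1 / 2) 1 (by norm_num) fun n => (hnext n (s n) (hs n)).2.1)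
  obtain ⟨v, hv⟩ := cauchySeq_tendsto_of_complete (cauchySeq_of_le_geometric (f := fun n => (s n).2)
    (1 / 2) 1 (by norm_num) fun n => (hnext n (s n) (hs n)).2.2)
  have huT : u ∈ T := hTc.mem_of_tendsto hu (Eventually.of_forall fun n => interior_subset (hs n).1)
  have hvT : v ∈ T :=
    hTc.mem_of_tendsto hv (Eventually.of_forall fun n => interior_subset (hs n).2.1)
  have huv : u • i y = v • i z := by
    by_contra hne
    obtain ⟨P₁, P₂, hP₁, hP₂, huP, hvP, hdisj⟩ := t2_separation hne
    have hvlim : Tendsto (fun n => (s n).2 • i z) atTop (𝓝 (v • i z)) := hv.smul_const _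
    obtain ⟨n₀, hn₀⟩ := eventually_atTop.1 (hvlim.eventually_mem (hP₂.mem_nhds hvP))
    -- elements `w n` with `w n • (s n).1 • y` in `P₂` eventually, although they converge to `u • y`
    have hw : ∀ n, ∃ w ∈ S n (s n).1, n₀ ≤ n → w • (s n).1 • i y ∈ P₂ := by
      intro n
      by_cases hn : n₀ ≤ n
      · obtain ⟨w, hw, hwP⟩ := (hs n).2.2 (i ⁻¹' P₂) (actionOpen_preimage hi hsmul hP₂)
          (by simpa [hsmul] using hn₀ n hn)
        exact ⟨w, hw, fun _ => by simpa [hsmul] using hwP⟩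
      · obtain ⟨w, hw, -⟩ := (hs n).2.2 univ (by simp [ActionOpen]) trivial
        exact ⟨w, hw, fun h => absurd h hn⟩
    choose w hwS hwP using hw
    have hlim : Tendsto (fun n => w n * (s n).1) atTop (𝓝 u) := by
      refine tendsto_of_tendsto_of_dist hu ?_
      refine squeeze_zero (fun _ => dist_nonneg) (fun n => ?_)
        (tendsto_pow_atTop_nhds_zero_of_lt_one (r := (1 / 2 : ℝ)) (by norm_num) (by norm_num))
      rw [dist_comm]
      exact (hwS n).2.le
    have hlim' : Tendsto (fun n => (w n * (s n).1) • i y) atTop (𝓝 (u • i y)) :=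
      hlim.smul_const _
    obtain ⟨n, hnP, hn⟩ :=
      ((hlim'.eventually_mem (hP₁.mem_nhds huP)).and (eventually_ge_atTop n₀)).exists
    exact disjoint_left.1 hdisj hnP (by simpa [mul_smul] using hwP n hn)
  refine ⟨v⁻¹ * u, hWW (mk_mem_prod (hTW hvT) (hTW huT)), hinj ?_⟩
  rw [hsmul, mul_smul, huv, inv_smul_smul]

end

/-! ### Refining a Polish topology -/

theorem measurableSet_of_isOpen_of_le {Z : Type*} [t : TopologicalSpace Z] [hZ : PolishSpace Z]
    [MeasurableSpace Z] [BorelSpace Z] : ∀ τ : TopologicalSpace Z, τ ≤ t → @PolishSpace Z τ →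
      ∀ A, IsOpen[τ] A → MeasurableSet A := by
  intro τ hτ hτP A hA
  rw [@BorelSpace.measurable_eq Z t _ _, ← MeasureTheory.borel_eq_borel_of_le hτP hZ hτ]
  exact MeasurableSpace.measurableSet_generateFrom hA

/-- Countably many operations on sets that preserve Borel sets and commute with countable unions
preserve the open sets of some finer Polish topology, in which a given Borel set is closed. -/
theorem exists_polishSpace_le_isOpen_apply {Z J : Type*} [t : TopologicalSpace Z] [PolishSpace Z]
    [MeasurableSpace Z] [BorelSpace Z] [Countable J] (Φ : J → Set Z → Set Z)
    (hΦ : ∀ j A, MeasurableSet A → MeasurableSet (Φ j A))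
    (hU : ∀ j (S : Set (Set Z)), S.Countable → Φ j (⋃₀ S) = ⋃ s ∈ S, Φ j s)
    {E : Set Z} (hE : MeasurableSet E) :
    ∃ τ : TopologicalSpace Z, τ ≤ t ∧ @PolishSpace Z τ ∧ IsClosed[τ] E ∧
      ∀ j A, IsOpen[τ] A → IsOpen[τ] (Φ j A) := by
  have hclop : ∀ j A, MeasurableSet A → PolishSpace.IsClopenable (Φ j A) :=
    fun j A hA => (hΦ j A hA).isClopenable
  have hopen := measurableSet_of_isOpen_of_le (Z := Z)
  -- one refinement makes `Φ j A` open for the sets `A` open so far; the result is the infimum of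
  -- the topologies obtained by iterating it
  have hstep : ∀ τ : TopologicalSpace Z, τ ≤ t ∧ @PolishSpace Z τ →
      ∃ τ' : TopologicalSpace Z, (τ' ≤ t ∧ @PolishSpace Z τ') ∧ τ' ≤ τ ∧
        ∀ j A, IsOpen[τ] A → IsOpen[τ'] (Φ j A) := by
    rintro τ ⟨hτ, hτP⟩
    let b : Set (Set Z) := @TopologicalSpace.countableBasis Z τ _
    have hb : @TopologicalSpace.IsTopologicalBasis Z τ b :=
      @TopologicalSpace.isBasis_countableBasis Z τ _
    have hbc : b.Countable := @TopologicalSpace.countable_countableBasis Z τ _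
    have : Countable b := hbc.to_subtype
    have hmeas : ∀ a ∈ b, MeasurableSet a := fun a ha => hopen τ hτ hτP a
      (@TopologicalSpace.IsTopologicalBasis.isOpen Z τ _ _ hb ha)
    choose m hmt hmP _ hmo using
      fun p : J × b => hclop p.1 p.2 (hmeas _ p.2.2)
    obtain ⟨τ', hτ'm, hτ't, hτ'P⟩ := @PolishSpace.exists_polishSpace_forall_le Z _ _ t _
      (fun o : Option (J × b) => o.elim τ m) (Option.forall.2 ⟨hτ, hmt⟩)
      (Option.forall.2 ⟨hτP, hmP⟩)
    refine ⟨τ', ⟨hτ't, hτ'P⟩, hτ'm none, fun j A hA => ?_⟩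
    rw [@TopologicalSpace.IsTopologicalBasis.open_eq_sUnion' Z τ _ hb _ hA,
      hU j _ (hbc.mono fun s hs => hs.1)]
    exact @isOpen_biUnion Z _ τ' _ _ fun s hs => hτ'm (some (j, ⟨s, hs.1⟩)) _ (hmo _)
  choose! next hnext using hstep
  obtain ⟨τ₀, hτ₀t, hτ₀P, hτ₀E, -⟩ := hE.isClopenable
  let τ : ℕ → TopologicalSpace Z := fun n => Nat.rec τ₀ (fun _ => next) n
  have hτ : ∀ n, τ n ≤ t ∧ @PolishSpace Z (τ n) :=
    fun n => Nat.rec ⟨hτ₀t, hτ₀P⟩ (fun n ih => (hnext (τ n) ih).1) n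
  have hanti : Antitone τ := antitone_nat_of_succ_le fun n => (hnext (τ n) (hτ n)).2.1
  refine ⟨⨅ n, τ n, (iInf_le _ 0).trans hτ₀t,
    PolishSpace.iInf ⟨0, fun n => hanti n.zero_le⟩ fun n => (hτ n).2,
    IsClosed.mono hτ₀E (iInf_le τ 0), fun j A hA => ?_⟩
  have hA' : A = ⋃₀ range fun n => @interior Z (τ n) A := by
    refine subset_antisymm (fun a ha => ?_)
      (sUnion_subset (by rintro _ ⟨n, rfl⟩; exact @interior_subset Z (τ n) A))
    have hn := @IsOpen.mem_nhds Z (⨅ n, τ n) a A hA ha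
    rw [nhds_iInf, mem_iInf_of_directed] at hn
    · obtain ⟨n, hn⟩ := hn
      exact ⟨_, ⟨n, rfl⟩, (@mem_interior_iff_mem_nhds Z (τ n) a A).2 hn⟩
    · exact directed_of_isDirected_le fun m n hmn => nhds_mono (hanti hmn)
  rw [hA', hU j _ (countable_range _), biUnion_range]
  exact @isOpen_iUnion Z _ (⨅ n, τ n) _ fun n =>
    iInf_le τ (n + 1) _ ((hnext (τ n) (hτ n)).2.2 j _ (@isOpen_interior Z (τ n) A))

/-! ### The relations `y ∈ W • x` are Borel -/

theorem vaught_sUnion_left {G Z : Type*} [Group G] [TopologicalSpace G] [MulAction G Z]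
    {S : Set (Set Z)} (hS : S.Countable) (U : Set G) :
    vaught (⋃₀ S) U = ⋃ s ∈ S, vaught s U := by
  have : Countable S := hS.to_subtype
  ext z
  have := frequently_countable_exists (l := residual G) (p := fun (s : S) g => g ∈ U ∧ g • z ∈ s.1)
  simp only [vaught, mem_ofPred_eq, mem_iUnion, exists_prop, Subtype.exists] at this ⊢
  rw [← this]
  refine frequently_congr (Eventually.of_forall fun g => ?_)
  simp only [mem_sUnion]
  tauto

theorem vaught_sUnion_right {G Z : Type*} [Group G] [TopologicalSpace G] [MulAction G Z]
    (A : Set Z) {S : Set (Set G)} (hS : S.Countable) :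
    vaught A (⋃₀ S) = ⋃ s ∈ S, vaught A s := by
  have : Countable S := hS.to_subtype
  ext z
  have := frequently_countable_exists (l := residual G) (p := fun (s : S) g => g ∈ s.1 ∧ g • z ∈ A)
  simp only [vaught, mem_ofPred_eq, mem_iUnion, exists_prop, Subtype.exists] at this ⊢
  rw [← this]
  refine frequently_congr (Eventually.of_forall fun g => ?_)
  simp only [mem_sUnion]
  tauto

/-- The Vaught transform of a subset of `X × X` for the action of `G` on the second coordinate. -/
def fiberVaught {G X : Type*} [Group G] [TopologicalSpace G] [MulAction G X] (A : Set (X × X))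
    (U : Set G) : Set (X × X) :=
  {p | p.2 ∈ vaught (Prod.mk p.1 ⁻¹' A) U}

theorem fiberVaught_sUnion_left {G X : Type*} [Group G] [TopologicalSpace G] [MulAction G X]
    {S : Set (Set (X × X))} (hS : S.Countable) (U : Set G) :
    fiberVaught (⋃₀ S) U = ⋃ s ∈ S, fiberVaught s U := by
  ext p
  simp only [fiberVaught, mem_ofPred_eq, mem_iUnion]
  rw [show Prod.mk p.1 ⁻¹' (⋃₀ S) = ⋃₀ ((Prod.mk p.1 ⁻¹' ·) '' S) by simp [preimage_sUnion],
    vaught_sUnion_left (hS.image _), biUnion_image]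
  simp only [mem_iUnion]

theorem fiberVaught_sUnion_right {G X : Type*} [Group G] [TopologicalSpace G] [MulAction G X]
    (A : Set (X × X)) {S : Set (Set G)} (hS : S.Countable) :
    fiberVaught A (⋃₀ S) = ⋃ s ∈ S, fiberVaught A s := by
  ext p
  simp only [fiberVaught, mem_ofPred_eq, mem_iUnion, vaught_sUnion_right _ hS]

section

variable {G X : Type*} [Group G] [TopologicalSpace G] [PolishSpace G]
  [TopologicalSpace X] [PolishSpace X] [MeasurableSpace X] [BorelSpace X]
  [MulAction G X] [ContinuousSMul G X]

theorem measurableSet_fiberVaught {A : Set (X × X)} (hA : MeasurableSet A) {U : Set G}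
    (hU : IsOpen U) : MeasurableSet (fiberVaught A U) := by
  borelize G
  have : Measurable fun q : (X × X) × G => ((q.1.1, q.2 • q.1.2) : X × X) :=
    (by fun_prop : Continuous _).measurable
  exact measurableSet_frequently_residual (this hA) U hU

variable [IsTopologicalGroup G]

/-- If the orbit equivalence relation is Borel, the orbits have a common countable basis:
countably many Borel subsets of `X × X` whose sections at `x` restrict to a basis of the
quotient topology that the orbit of `x` carries as an image of `G`. -/
theorem IsBorelOrbitRel.exists_countable_basis (hE : IsBorelOrbitRel G X) :
    ∃ 𝒪 : Set (Set (X × X)), 𝒪.Countable ∧ (∀ O ∈ 𝒪, MeasurableSet O) ∧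
      (∀ O ∈ 𝒪, ∀ x : X, IsOpen {g : G | (x, g • x) ∈ O}) ∧
      ∀ x y : X, y ∈ MulAction.orbit G x → ∀ W ∈ 𝓝 (1 : G), ∃ O ∈ 𝒪, (x, y) ∈ O ∧
        ∀ z ∈ MulAction.orbit G x, (x, z) ∈ O → ∃ w ∈ W, z = w • y := by
  let bG := TopologicalSpace.countableBasis G
  have hbG := TopologicalSpace.isBasis_countableBasis G
  have hbGc : bG.Countable := TopologicalSpace.countable_countableBasis G
  have : Countable bG := hbGc.to_subtype
  have hfst : ∀ x : X, IsClosed {p : X × X | p.1 = x} :=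
    fun x => isClosed_singleton.preimage continuous_fst
  have hsnd : Continuous (Prod.snd : X × X → X) := continuous_snd
  have hbaire : ∀ (x y : X) (A : Set (X × X)), MeasurableSet A →
      BaireMeasurableSet {g : G | (x, g • y) ∈ A} := by
    intro x y A hA
    borelize G
    have : Measurable fun g : G => ((x, g • y) : X × X) := (by fun_prop : Continuous _).measurable
    exact (this hA).baireMeasurableSet
  have hopen := measurableSet_of_isOpen_of_le (Z := X × X)
  obtain ⟨τ, hτ, hτP, hτE, hτV⟩ := exists_polishSpace_le_isOpen_apply
    (fun (u : bG) (A : Set (X × X)) => fiberVaught A u.1)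
    (fun u A hA => measurableSet_fiberVaught hA (hbG.isOpen u.2))
    (fun u S hS => fiberVaught_sUnion_left hS u.1) hE
  have hV : ∀ (A : Set (X × X)) (U : Set G), IsOpen[τ] A → IsOpen U →
      IsOpen[τ] (fiberVaught A U) := by
    intro A U hA hU
    rw [hbG.open_eq_sUnion' hU, fiberVaught_sUnion_right _ (hbGc.mono fun s hs => hs.1)]
    exact @isOpen_biUnion _ _ τ _ _ fun s hs => hτV ⟨s, hs.1⟩ A hA
  have hmeas : ∀ A, IsOpen[τ] A → MeasurableSet A := hopen τ hτ hτP
  let b : Set (Set (X × X)) := @TopologicalSpace.countableBasis _ τ _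
  have hb : @TopologicalSpace.IsTopologicalBasis _ τ b :=
    @TopologicalSpace.isBasis_countableBasis _ τ _
  have hbc : b.Countable := @TopologicalSpace.countable_countableBasis _ τ _
  have hbo : ∀ a ∈ b, IsOpen[τ] a :=
    fun a ha => @TopologicalSpace.IsTopologicalBasis.isOpen _ τ _ _ hb ha
  -- the theory of the action topology, for the orbit of `x` with the topology of `{x} × orbit`
  have horbit : ∀ x : X, (∀ (A : Set (X × X)) (U : Set G), IsOpen[τ] A → IsOpen U →
      IsOpen {g : G | (x, g • x) ∈ fiberVaught A U}) ∧
      ∀ y ∈ MulAction.orbit G x, ∀ W ∈ 𝓝 (1 : G), ∃ (A : Set (X × X)) (U : Set G),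
        IsOpen[τ] A ∧ IsOpen U ∧ (x, y) ∈ fiberVaught A U ∧
        ∀ z ∈ MulAction.orbit G x, (x, z) ∈ fiberVaught A U → ∃ w ∈ W, z = w • y := by
    intro x
    let f : MulAction.orbit G x → X × X := fun y => (x, y.1)
    let tY : TopologicalSpace (MulAction.orbit G x) := TopologicalSpace.induced f τ
    have hf : @IsClosedEmbedding _ _ tY τ f := by
      refine @IsClosedEmbedding.mk _ _ tY τ f (@IsEmbedding.mk _ _ tY τ f
        (@IsInducing.mk _ _ tY τ f rfl) fun y z h => Subtype.ext (Prod.ext_iff.1 h).2) ?_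
      have hrange : range f = {p : X × X | MulAction.orbitRel G X p.1 p.2} ∩ {p | p.1 = x} := by
        ext p
        constructor
        · rintro ⟨y, rfl⟩
          exact ⟨MulAction.mem_orbit_symm.1 y.2, rfl⟩
        · rintro ⟨hp, rfl⟩
          exact ⟨⟨p.2, MulAction.mem_orbit_symm.1 hp⟩, rfl⟩
      rw [hrange]
      refine @IsClosed.inter _ _ _ τ hτE (IsClosed.mono (hfst x) hτ)
    have hYP : PolishSpace (MulAction.orbit G x) :=
      @IsClosedEmbedding.polishSpace _ _ tY τ hτP f hf
    have hi : Continuous (Subtype.val : MulAction.orbit G x → X) := by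
      have h1 : @Continuous _ _ tY τ f := continuous_induced_dom
      have h2 : @Continuous _ _ τ _ (Prod.snd : X × X → X) := continuous_le_dom hτ hsnd
      exact @Continuous.comp _ _ _ tY τ _ _ _ h2 h1
    have hB : ∀ (y : MulAction.orbit G x) (Q : Set (MulAction.orbit G x)), IsOpen Q →
        BaireMeasurableSet ((fun g : G => g • y) ⁻¹' Q) := by
      rintro y Q hQ
      obtain ⟨Q', hQ', rfl⟩ := isOpen_induced_iff.1 hQ
      exact hbaire x y.1 Q' (hmeas Q' hQ')
    have hVY : ∀ (A : Set (MulAction.orbit G x)) (U : Set G), IsOpen A → IsOpen U →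
        IsOpen (vaught A U) := by
      rintro A U hA hU
      obtain ⟨A', hA', rfl⟩ := isOpen_induced_iff.1 hA
      exact isOpen_induced_iff.2 ⟨_, hV A' U hA' hU, rfl⟩
    refine ⟨fun A U hA hU => ?_, fun y hy W hW => ?_⟩
    · have h1 : ActionOpen G (vaught (f ⁻¹' A) U) :=
        actionOpen_vaught hB hVY (isOpen_induced_iff.2 ⟨A, hA, rfl⟩) hU
      have h2 : Continuous fun g : G => ((g, ⟨x, MulAction.mem_orbit_self x⟩) :
        G × MulAction.orbit G x) := by fun_prop
      exact h1.preimage h2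
    · obtain ⟨N, hN, hyN, hNW⟩ := exists_actionOpen_subset_smul hi (fun _ _ => rfl)
        Subtype.val_injective hB hVY hW ⟨y, hy⟩
      obtain ⟨A, U, hA, hU, hyA, hAN⟩ := hN.exists_vaught_subset hB hyN
      obtain ⟨A', hA', rfl⟩ := isOpen_induced_iff.1 hA
      refine ⟨A', U, hA', hU, hyA, fun z hz hzA => ?_⟩
      obtain ⟨w, hw, hzw⟩ := hNW ⟨z, hz⟩ (hAN hzA)
      exact ⟨w, hw, congrArg Subtype.val hzw⟩
  refine ⟨(fun q : Set (X × X) × Set G => fiberVaught q.1 q.2) '' (b ×ˢ bG),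
    (hbc.prod hbGc).image _, ?_, ?_, ?_⟩
  · rintro _ ⟨⟨a, u⟩, ⟨ha, hu⟩, rfl⟩
    exact measurableSet_fiberVaught (hmeas a (hbo a ha)) (hbG.isOpen hu)
  · rintro _ ⟨⟨a, u⟩, ⟨ha, hu⟩, rfl⟩ x
    exact (horbit x).1 a u (hbo a ha) (hbG.isOpen hu)
  · intro x y hy W hW
    obtain ⟨A, U, hA, hU, hmem, hAU⟩ := (horbit x).2 y hy W hW
    have hmem' := hmem
    rw [@TopologicalSpace.IsTopologicalBasis.open_eq_sUnion' _ τ _ hb _ hA,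
      fiberVaught_sUnion_left (hbc.mono fun s hs => hs.1)] at hmem'
    simp only [mem_iUnion] at hmem'
    obtain ⟨a, ⟨ha, haA⟩, hmem'⟩ := hmem'
    rw [hbG.open_eq_sUnion' hU, fiberVaught_sUnion_right _ (hbGc.mono fun s hs => hs.1)] at hmem'
    simp only [mem_iUnion] at hmem'
    obtain ⟨u, ⟨hu, huU⟩, hmem'⟩ := hmem'
    refine ⟨_, ⟨(a, u), ⟨ha, hu⟩, rfl⟩, hmem', fun z hz hzO => hAU z hz ?_⟩
    exact vaught_mono (preimage_mono haA) huU hzO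

/-- A theorem of Becker and Kechris: if the orbit equivalence relation is Borel,
so is `{(x, y) | y ∈ W • x}` for open `W`. -/
theorem IsBorelOrbitRel.measurableSet_exists_smul_eq (hE : IsBorelOrbitRel G X) {W : Set G}
    (hW : IsOpen W) : MeasurableSet {p : X × X | ∃ g ∈ W, g • p.1 = p.2} := by
  obtain ⟨𝒪, h𝒪c, h𝒪m, h𝒪o, h𝒪⟩ := hE.exists_countable_basis
  obtain ⟨g, hg⟩ := TopologicalSpace.exists_dense_seq G
  have hb := TopologicalSpace.isBasis_countableBasis G
  -- `p.2` lies in the closure of `U • p.1` within the orbit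
  let R : Set G → Set (X × X) := fun U => {p | MulAction.orbitRel G X p.1 p.2} \
    ⋃ O ∈ 𝒪, O ∩ ⋂ k, {p | g k ∈ U → (p.1, g k • p.1) ∉ O}
  have hR : ∀ U, MeasurableSet (R U) := by
    intro U
    refine MeasurableSet.diff hE (MeasurableSet.biUnion h𝒪c fun O hO =>
      (h𝒪m O hO).inter (MeasurableSet.iInter fun k => ?_))
    by_cases hk : g k ∈ U
    · have : Measurable fun p : X × X => ((p.1, g k • p.1) : X × X) :=
        (by fun_prop : Continuous _).measurable
      simp only [hk, true_imp_iff]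
      exact (this (h𝒪m O hO)).compl
    · simp [hk]
  have key : {p : X × X | ∃ g ∈ W, g • p.1 = p.2} =
      ⋃ U ∈ {U ∈ TopologicalSpace.countableBasis G | ∃ W₀ ∈ 𝓝 (1 : G), W₀⁻¹ * U ⊆ W}, R U := by
    ext ⟨x, y⟩
    simp only [mem_ofPred_eq, mem_iUnion, exists_prop]
    constructor
    · rintro ⟨h, hh, rfl⟩
      have hcont : Continuous fun q : G × G => q.1⁻¹ * q.2 := by fun_prop
      have := (hW.preimage hcont).mem_nhds (show ((1, h) : G × G) ∈ _ by simpa using hh)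
      rw [nhds_prod_eq, mem_prod_iff] at this
      obtain ⟨W₀, hW₀, U, hU, hWU⟩ := this
      obtain ⟨U', hU', hhU', hUU'⟩ := hb.mem_nhds_iff.1 hU
      refine ⟨U', ⟨hU', W₀, hW₀, ?_⟩, MulAction.mem_orbit_symm.1 ⟨h, rfl⟩, ?_⟩
      · rintro _ ⟨a, ha, u, hu, rfl⟩
        simpa using hWU (mk_mem_prod ha (hUU' hu))
      · simp only [mem_iUnion, mem_inter_iff, mem_iInter, mem_ofPred_eq, not_exists]
        rintro O hO ⟨hmem, hk⟩
        obtain ⟨k, hkU⟩ := hg.exists_mem_open ((hb.isOpen hU').inter (h𝒪o O hO x)) ⟨h, hhU', hmem⟩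
        exact hk k hkU.1 hkU.2
    · rintro ⟨U, ⟨hU, W₀, hW₀, hWU⟩, hxy, hR⟩
      obtain ⟨O, hO, hmem, hsub⟩ := h𝒪 x y (MulAction.mem_orbit_symm.1 hxy) W₀ hW₀
      simp only [mem_iUnion, mem_inter_iff, mem_iInter, mem_ofPred_eq, not_exists, not_and,
        not_forall, not_not] at hR
      obtain ⟨k, hkU, hkO⟩ := hR O hO hmem
      obtain ⟨w, hw, hwk⟩ := hsub _ ⟨g k, rfl⟩ hkO
      exact ⟨w⁻¹ * g k, hWU (mul_mem_mul (inv_mem_inv.2 hw) hkU), by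
        simp only at hwk ⊢
        rw [mul_smul, hwk, inv_smul_smul]⟩
  rw [key]
  exact MeasurableSet.biUnion
    ((TopologicalSpace.countable_countableBasis G).mono fun U hU => hU.1) fun U _ => hR U

/-! ### Extending a lacunary section -/

/-- For basic open `O` with `O⁻¹ * O ⊆ V`, lacunarity makes the second projection injective on
`{(c, y) | c ∈ C, y ∈ O • c}`, so that its image `O • C` is Borel by the Lusin–Souslin theorem. -/
theorem IsLacunary.measurableSet_smul (hE : IsBorelOrbitRel G X) {V : Set G} (hV : IsOpen V)
    (h1 : (1 : G) ∈ V) {C : Set X} (hC : MeasurableSet C) (hlac : IsLacunary V C) :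
    MeasurableSet (V • C) := by
  have hb := TopologicalSpace.isBasis_countableBasis G
  have key : V • C = ⋃ O ∈ {O ∈ TopologicalSpace.countableBasis G | O ⊆ V ∧ O⁻¹ * O ⊆ V},
      Prod.snd '' ({p : X × X | ∃ g ∈ O, g • p.1 = p.2} ∩ Prod.fst ⁻¹' C) := by
    ext y
    simp only [mem_iUnion, exists_prop]
    constructor
    · rintro ⟨v, hv, c, hc, rfl⟩
      have hcont : Continuous fun q : G × G => q.1⁻¹ * q.2 := by fun_prop
      have := (hV.preimage hcont).mem_nhds (show ((v, v) : G × G) ∈ _ by simpa using h1)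
      rw [nhds_prod_eq, mem_prod_same_iff] at this
      obtain ⟨N, hN, hNV⟩ := this
      obtain ⟨O, hO, hvO, hON⟩ := hb.mem_nhds_iff.1 (inter_mem hN (hV.mem_nhds hv))
      refine ⟨O, ⟨hO, fun o ho => (hON ho).2, ?_⟩, (c, v • c), ⟨⟨v, hvO, rfl⟩, hc⟩, rfl⟩
      rintro _ ⟨a, ha, o, ho, rfl⟩
      simpa using hNV (mk_mem_prod (hON ha).1 (hON ho).1)
    · rintro ⟨O, ⟨-, hOV, -⟩, p, ⟨⟨o, ho, hop⟩, hc⟩, rfl⟩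
      exact ⟨o, hOV ho, p.1, hc, hop⟩
  rw [key]
  refine MeasurableSet.biUnion
    ((TopologicalSpace.countable_countableBasis G).mono fun O hO => hO.1) fun O hO => ?_
  refine ((hE.measurableSet_exists_smul_eq (hb.isOpen hO.1)).inter
    (measurable_fst hC)).image_of_measurable_injOn measurable_snd ?_
  rintro ⟨c, y⟩ ⟨⟨o, ho, hoc⟩, hc⟩ ⟨c', y'⟩ ⟨⟨o', ho', hoc'⟩, hc'⟩ (rfl : y = y')
  refine Prod.ext (hlac (o'⁻¹ * o) (hO.2.2 (mul_mem_mul (inv_mem_inv.2 ho') ho)) c hc c' hc' ?_) rfl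
  simp only at hoc hoc'
  rw [mul_smul, hoc, ← hoc', inv_smul_smul]

end

theorem IsLacunary.smul {G X : Type*} [Group G] [MulAction G X] {V : Set G} {B : Set X}
    (hB : IsLacunary V B) (hconj : ∀ g : G, ∀ v ∈ V, g * v * g⁻¹ ∈ V) (g : G) :
    IsLacunary V (g • B) := by
  rintro v hv _ ⟨x, hx, rfl⟩ _ ⟨y, hy, rfl⟩ h
  have := hB (g⁻¹ * v * g) (by simpa using hconj g⁻¹ v hv) x hx y hy
    (by simp only [mul_smul]; simp only at h; rw [h, inv_smul_smul])
  simp only [this]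

theorem IsLacunary.union_diff_smul {G X : Type*} [Group G] [MulAction G X] {V : Set G}
    {C D : Set X} (hsymm : V⁻¹ = V) (hC : IsLacunary V C) (hD : IsLacunary V D) :
    IsLacunary V (C ∪ D \ V • C) := by
  rintro g hg x (hx | hx) y (hy | hy) h
  · exact hC g hg x hx y hy h
  · exact absurd ⟨g, hg, x, hx, h⟩ hy.2
  · have hg' : g⁻¹ ∈ V := by rw [← hsymm]; simpa using hg
    exact absurd ⟨g⁻¹, hg', y, hy, by simp [← h]⟩ hx.2
  · exact hD g hg x hx.1 y hy.1 h

theorem mainTheorem5 {G X : Type*}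
    [Group G] [TopologicalSpace G] [IsTopologicalGroup G] [PolishSpace G]
    [TopologicalSpace X] [PolishSpace X] [MeasurableSpace X] [BorelSpace X]
    [MulAction G X] [ContinuousSMul G X]
    (hG : AdmitsTwoSidedInvariantMetric G)
    (hE : IsBorelOrbitRel G X)
    (V : Set G) (hVopen : IsOpen V) (hVone : (1 : G) ∈ V) (hVsymm : V⁻¹ = V)
    (hVconj : ∀ g : G, ∀ v ∈ V, g * v * g⁻¹ ∈ V)
    (B : Set X) (hBorel : MeasurableSet B) (hBlac : IsLacunary V B)
    (hBcs : IsCompleteSection G B) :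
    ∃ C : Set X, B ⊆ C ∧ MeasurableSet C ∧ IsLacunary V C ∧ IsCompleteSection G C ∧
      (V * V) • C = Set.univ := by
  obtain ⟨g, hg⟩ := TopologicalSpace.exists_dense_seq G
  let C : ℕ → Set X := fun n => Nat.rec B (fun n D => D ∪ (g n • B) \ V • D) n
  have hC : ∀ n, MeasurableSet (C n) ∧ IsLacunary V (C n) := by
    intro n
    induction n with
    | zero => exact ⟨hBorel, hBlac⟩
    | succ n ih =>
      have hgB : MeasurableSet (g n • B) := by
        rw [← preimage_smul_inv]
        exact (continuous_const_smul (g n)⁻¹).measurable hBorel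
      exact ⟨ih.1.union (hgB.diff (ih.2.measurableSet_smul hE hVopen hVone ih.1)),
        ih.2.union_diff_smul hVsymm (hBlac.smul hVconj (g n))⟩
  have hmono : Monotone C := monotone_nat_of_le_succ fun n => subset_union_left
  have hBC : B ⊆ ⋃ n, C n := subset_iUnion C 0
  refine ⟨⋃ n, C n, hBC, MeasurableSet.iUnion fun n => (hC n).1, ?_, fun x => ?_, ?_⟩
  · intro h hh x hx y hy hxy
    obtain ⟨m, hm⟩ := mem_iUnion.1 hx
    obtain ⟨n, hn⟩ := mem_iUnion.1 hy
    exact (hC (max m n)).2 h hh x (hmono (le_max_left m n) hm) y (hmono (le_max_right m n) hn) hxy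
  · obtain ⟨b, hb, hbx⟩ := hBcs x
    exact ⟨b, hBC hb, hbx⟩
  · refine eq_univ_of_forall fun x => ?_
    obtain ⟨b, hb, hbx⟩ := hBcs x
    obtain ⟨h, rfl⟩ := MulAction.mem_orbit_symm.1 hbx
    -- some `g n` has `h ∈ V * g n`, so that `h • b ∈ V • (g n • B)`
    have hcont : Continuous fun k : G => h * k⁻¹ := by fun_prop
    obtain ⟨n, hn⟩ := hg.exists_mem_open (hVopen.preimage hcont) ⟨h, by simpa using hVone⟩
    have hx : (h * (g n)⁻¹) • g n • b = h • b := by simp [← mul_smul]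
    by_cases hmem : g n • b ∈ V • C n
    · obtain ⟨v, hv, c, hc, hvc⟩ := hmem
      refine ⟨h * (g n)⁻¹ * v, mul_mem_mul hn hv, c, mem_iUnion.2 ⟨n, hc⟩, ?_⟩
      simp only at hvc ⊢
      rw [mul_smul, hvc, hx]
    · refine ⟨h * (g n)⁻¹ * 1, mul_mem_mul hn hVone, g n • b,
        mem_iUnion.2 ⟨n + 1, Or.inr ⟨smul_mem_smul_set hb, hmem⟩⟩, ?_⟩
      simpa using hx
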